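/- **Setting.** In a metrical task system (MTS) on a finite metric space $(M,d)$ with starting state $x_0$, at each time $t=1,\dots,T$ a cost function $\ell_t:M\to[0,\infty]$ arrives, and an online algorithm, not knowing the future nor $T$, chooses a state $x_t$ and pays $d(x_{t-1},x_t)+\ell_t(x_t)$. $\mathrm{OPT}$ is the minimum total cost of an offline solution. An *optimal offline algorithm* $\mathrm{OFF}$ outputs for every instance a solution $o_1,\dots,o_T$ of cost $\mathrm{OPT}$. At time $t$, after seeing $\ell_t$ and before choosing $x_t$, an algorithm may query an action predictor and then receives a state $p_t\in M$. It receives predictions *at most once in $a$ time steps* if any two of its queries are at least $a$ steps apart. The prediction error with respect to $\mathrm{OFF}$ is $\eta=\sum d(p_t,o_t)$, the sum being over the times $t\le T$ at which it queries. A randomized algorithm is a random deterministic algorithm; conditions on its error are meant almost surely. For $\rho\ge 0$, an algorithm has *competitive ratio at most $r$ with error at most $\rho\,\mathrm{OPT}$* if there is a constant $\kappa$ such that $\mathbb E[\mathrm{cost}]\le r\cdot\mathrm{OPT}+\kappa$ for all instances and predictions with $\eta\le\rho\cdot\mathrm{OPT}$. For $g:[0,\infty)\to[0,\infty)$, it is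 *$g(\eta/\mathrm{OPT})$-smooth* if for every $\rho\ge0$ its competitive ratio with error at most $\rho\,\mathrm{OPT}$ is at most $g(\rho)$. On the $n$-point uniform metric (all distances between distinct points are $1$), let $\alpha_n^{\det}$ and $\alpha_n^{\mathrm{rand}}$ be the infimum of all $r$ for which there is a deterministic, respectively randomized, $r$-competitive online algorithm that uses no predictions. **Theorem.** There are absolute constants $c,C>0$ such that the following holds. 1. $c\,n\le\alpha_n^{\det}\le C\,n$ for all $n\ge1$, and $c\log n\le\alpha_n^{\mathrm{rand}}\le C\log n$ for all $n\ge2$. 2. Let $n,a\ge1$, let $x_0$ be a starting state, let $\mathrm{OFF}$ be an optimal offline algorithm for MTS on the $n$-point uniform metric, and let $\rho\ge0$. If a deterministic online algorithm that receives predictions at most once in $a$ time steps has competitive ratio at most $r$ with error (with respect to $\mathrm{OFF}$) at most $\rho\,\mathrm{OPT}$, then $r\ge c\cdot\min\{\alpha_n^{\det},\,1+a\rho\}$. The same holds for randomized algorithms with $\alpha_n^{\mathrm{rand}}$ in place of $\alpha_n^{\det}$. That is, the competitive ratio is $\Omega(\min\{\alpha_n,1+a\eta/\mathrm{OPT}\})$.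 3. Hence no algorithm receiving predictions at most once in $a$ time steps is $o(a\eta/\mathrm{OPT})$-smooth: fix an optimal offline algorithm for each $n$ and each starting state, and let $f:\mathbb N\times[0,\infty)\to[0,\infty)$, $a_k\in\mathbb N$ and $\rho_k\ge0$ be such that $a_k\rho_k\to\infty$ and $f(a_k,\rho_k)=o(a_k\rho_k)$ as $k\to\infty$. Then for all sufficiently large $k$ there is no family of (deterministic or randomized) online algorithms, one for each $n$ and each starting state in the $n$-point uniform metric, all of which receive predictions at most once in $a_k$ time steps and are $f(a_k,\eta/\mathrm{OPT})$-smooth. (For instance, one may take $a_k=a$ fixed and $\rho_k\to\infty$.) -/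

import Mathlib

open scoped NNReal ENNReal
open MeasureTheory Filter Asymptotics

namespace MTS

/-- The `n`-point uniform metric space: any two distinct points are at distance `1`. -/
def UniformMetric (n : ℕ) : Type := Fin n

namespace UniformMetric

instance (n : ℕ) : DecidableEq (UniformMetric n) := inferInstanceAs (DecidableEq (Fin n))

instance (n : ℕ) : Fintype (UniformMetric n) := inferInstanceAs (Fintype (Fin n))

noncomputable instance (n : ℕ) : MetricSpace (UniformMetric n) where
  dist x y := if x = y then 0 else 1
  dist_self x := by simp
  dist_comm x y := by simp [eq_comm]
  dist_triangle x y z := by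
    by_cases hxy : x = y
    · subst hxy; simp
    · by_cases hxz : x = z
      · simp only [hxz, if_true]; positivity
      · simp only [hxy, hxz, if_false]
        split_ifs <;> norm_num
  eq_of_dist_eq_zero {x y} h := by
    by_contra hne
    simp [hne] at h

end UniformMetric

variable {M : Type}

/-! ### Metrical task systems

A request sequence is `ℓ 1, …, ℓ T` (the value `ℓ 0` and the values after the horizon `T` play no
role); a solution is `y 0, y 1, …, y T`, where `y 0` is the predefined starting state. -/

/-- A cost function (task) on the set `M` of states; infinite costs are allowed. -/
abbrev CostFn (M : Type) : Type := M → ℝ≥0∞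

/-- The cost `∑_{t=1}^T (d(y_{t-1}, y_t) + ℓ_t(y_t))` of a solution. -/
noncomputable def cost [MetricSpace M] (ℓ : ℕ → CostFn M) (T : ℕ) (y : ℕ → M) : ℝ≥0∞ :=
  ∑ t ∈ Finset.range T, (edist (y t) (y (t + 1)) + ℓ (t + 1) (y (t + 1)))

/-- The offline optimum: the least cost of a solution starting in `x₀`. -/
noncomputable def opt [MetricSpace M] (x₀ : M) (ℓ : ℕ → CostFn M) (T : ℕ) : ℝ≥0∞ :=
  ⨅ (y : ℕ → M) (_ : y 0 = x₀), cost ℓ T y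

/-- An optimal offline algorithm: it sees the whole instance and outputs a solution of
minimum cost. -/
structure OptimalOffline [MetricSpace M] (x₀ : M) where
  sol : (ℕ → CostFn M) → ℕ → ℕ → M
  sol_zero : ∀ ℓ T, sol ℓ T 0 = x₀
  optimal : ∀ ℓ T, cost ℓ T (sol ℓ T) = opt x₀ ℓ T

/-! ### Online algorithms querying an action predictor -/

/-- What an online algorithm has seen: the tasks received so far, in order of arrival, each with the
answer of the predictor in that time step (`none` if the predictor was not queried). -/
abbrev History (M : Type) : Type := List (CostFn M × Option M)

/-- A deterministic online algorithm. In each time step it receives a task, decides from the history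
and that task whether to query the predictor, receives the answer if it does, and then decides from
the history, which now includes the current step, to which state it moves. -/
structure DetAlg (M : Type) where
  query : History M → CostFn M → Bool
  move : History M → M

namespace DetAlg

/-- The history after `t` time steps, where `p t` is the state which the predictor reports if it is
queried at time `t`. -/
def hist (A : DetAlg M) (ℓ : ℕ → CostFn M) (p : ℕ → M) : ℕ → History M
  | 0 => []
  | t + 1 => hist A ℓ p t ++
      [(ℓ (t + 1), if A.query (hist A ℓ p t) (ℓ (t + 1)) then some (p (t + 1)) else none)]

variable (A : DetAlg M)

/-- The state of the algorithm at time `t`. -/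
def state (x₀ : M) (ℓ : ℕ → CostFn M) (p : ℕ → M) : ℕ → M
  | 0 => x₀
  | t + 1 => A.move (A.hist ℓ p (t + 1))

/-- Whether the algorithm queries the predictor at time `t`, for `t ≥ 1`. -/
def queried (ℓ : ℕ → CostFn M) (p : ℕ → M) : ℕ → Bool
  | 0 => false
  | t + 1 => A.query (A.hist ℓ p t) (ℓ (t + 1))

/-- The total prediction error: the sum, over the time steps `t ≤ T` with a query, of the distances
of the received prediction from the state of the offline solution `o`. -/
noncomputable def predError [MetricSpace M] (ℓ : ℕ → CostFn M) (p : ℕ → M) (T : ℕ)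
    (o : ℕ → M) : ℝ≥0∞ :=
  ∑ t ∈ Finset.range T, if A.queried ℓ p (t + 1) then edist (p (t + 1)) (o (t + 1)) else 0

/-- Any two queries are separated by at least `a` time steps. -/
def WellSeparated (a : ℕ) : Prop :=
  ∀ (ℓ : ℕ → CostFn M) (p : ℕ → M) (s t : ℕ), s < t →
    A.queried ℓ p s = true → A.queried ℓ p t = true → s + a ≤ t

/-- The algorithm does not use predictions. -/
def NeverQueries : Prop := ∀ h c, A.query h c = false

end DetAlg

/-- A randomized online algorithm: a random deterministic one, chosen from a probability space, such
that on every instance its states and queries are random variables. -/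
structure RandAlg (M : Type) where
  Ω : Type
  [mΩ : MeasurableSpace Ω]
  μ : Measure Ω
  [prob : IsProbabilityMeasure μ]
  alg : Ω → DetAlg M
  measurable_state : ∀ (x₀ : M) (ℓ : ℕ → CostFn M) (p : ℕ → M) (t : ℕ) (S : Set M),
    MeasurableSet {ω | (alg ω).state x₀ ℓ p t ∈ S}
  measurable_queried : ∀ (ℓ : ℕ → CostFn M) (p : ℕ → M) (t : ℕ),
    MeasurableSet {ω | (alg ω).queried ℓ p t = true}

attribute [instance] RandAlg.mΩ RandAlg.prob

/-- A deterministic algorithm as a (degenerate) randomized one. -/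
noncomputable def DetAlg.toRand (A : DetAlg M) : RandAlg M where
  Ω := Unit
  μ := Measure.dirac ()
  alg := fun _ => A
  measurable_state := fun _ _ _ _ _ => MeasurableSpace.measurableSet_top
  measurable_queried := fun _ _ _ => MeasurableSpace.measurableSet_top

namespace RandAlg

variable (R : RandAlg M)

/-- In every outcome, any two queries are separated by at least `a` time steps. -/
def WellSeparated (a : ℕ) : Prop := ∀ ω, (R.alg ω).WellSeparated a

/-- The algorithm does not use predictions. -/
def NeverQueries : Prop := ∀ ω, (R.alg ω).NeverQueries

variable [MetricSpace M]

/-- The expected cost of the algorithm on `ℓ 1, …, ℓ T` with the predictor `p`. -/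
noncomputable def expectedCost (x₀ : M) (ℓ : ℕ → CostFn M) (p : ℕ → M) (T : ℕ) : ℝ≥0∞ :=
  ∫⁻ ω, cost ℓ T ((R.alg ω).state x₀ ℓ p) ∂(R.μ)

/-- `r`-competitiveness on all instances, whatever the predictor says. -/
def IsCompetitive (x₀ : M) (r : ℝ≥0) : Prop :=
  ∃ κ : ℝ≥0, ∀ (ℓ : ℕ → CostFn M) (p : ℕ → M) (T : ℕ),
    R.expectedCost x₀ ℓ p T ≤ r * opt x₀ ℓ T + κ

/-- `r`-competitiveness whenever the total prediction error `η` with respect to the optimal offline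
algorithm `off` satisfies `η ≤ ρ · OPT`. -/
def IsCompetitiveWithError (x₀ : M) (off : OptimalOffline x₀) (ρ r : ℝ≥0) : Prop :=
  ∃ κ : ℝ≥0, ∀ (ℓ : ℕ → CostFn M) (p : ℕ → M) (T : ℕ),
    (∀ᵐ ω ∂(R.μ), (R.alg ω).predError ℓ p T (off.sol ℓ T) ≤ ρ * opt x₀ ℓ T) →
      R.expectedCost x₀ ℓ p T ≤ r * opt x₀ ℓ T + κ

/-- `g(η / OPT)`-smoothness: for every `ρ`, the competitive ratio is at most `g ρ` whenever the
total prediction error is at most `ρ · OPT`. -/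
def IsSmooth (x₀ : M) (off : OptimalOffline x₀) (g : ℝ≥0 → ℝ≥0) : Prop :=
  ∀ ρ : ℝ≥0, R.IsCompetitiveWithError x₀ off ρ (g ρ)

end RandAlg

/-- The optimal competitive ratio of deterministic algorithms without predictions. -/
noncomputable def detRatio [MetricSpace M] (x₀ : M) : ℝ≥0∞ :=
  ⨅ (r : ℝ≥0) (_ : ∃ A : DetAlg M, A.NeverQueries ∧ A.toRand.IsCompetitive x₀ r), (r : ℝ≥0∞)

/-- The optimal competitive ratio of randomized algorithms without predictions. -/
noncomputable def randRatio [MetricSpace M] (x₀ : M) : ℝ≥0∞ :=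
  ⨅ (r : ℝ≥0) (_ : ∃ R : RandAlg M, R.NeverQueries ∧ R.IsCompetitive x₀ r), (r : ℝ≥0∞)

end MTS

namespace MTS

/-! ### Causality, costs and query counts. -/

section General

variable {M : Type}

/-! Lower bounds come from an adversary against an algorithm whose predictor always answers `x₀`. A
phase has `k` tasks, each charging `1` outside a shrinking set of survivors chosen so that the
algorithm is outside with probability at least `q`, then one task charging `1` everywhere. A phase
costs the algorithm at least `k * q + 1`, while the optimum grows by between `1` and `2` on average
(`RandAlg.exists_hard_instance`). Deterministically one survivor is lost per task and `q = 1`;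
against randomization the survivors are halved and `q = 1/2`.

With queries `a` steps apart, `N` phases contain at most about `N * (k + 1) / a` queries, each of
error at most `1`. If `k + 1 < a * ρ`, this is within `ρ * OPT` for large `N`, whatever `OFF` does.
The useless predictor is then admissible and `r ≥ (k * q + 1) / 2`. Taking `k` close to `a * ρ`, or
as large as `n` allows, gives the minimum.

To compare this with the ratios without predictions, these need upper bounds of the same order. They
come from a potential argument for the marking algorithm (`markingAlg_invariant`), run with a fixed
or a uniformly random order. Non-smoothness follows by choosing `n` so large that the minimum is `1
+ a * ρ`. -/

theorem DetAlg.hist_congr (A : DetAlg M) {ℓ ℓ' : ℕ → CostFn M} (p : ℕ → M) {T : ℕ}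
    (h : ∀ s ≤ T, ℓ s = ℓ' s) : ∀ t ≤ T, A.hist ℓ p t = A.hist ℓ' p t
  | 0, _ => rfl
  | t + 1, ht => by
    simp only [DetAlg.hist, A.hist_congr p h t (by omega), h (t + 1) ht]

/-- Causality lets the adversary choose the next task after inspecting the current state. -/
theorem DetAlg.state_congr (A : DetAlg M) (x₀ : M) {ℓ ℓ' : ℕ → CostFn M} (p : ℕ → M) {T : ℕ}
    (h : ∀ s ≤ T, ℓ s = ℓ' s) {t : ℕ} (ht : t ≤ T) :
    A.state x₀ ℓ p t = A.state x₀ ℓ' p t := by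
  cases t with
  | zero => rfl
  | succ t => simp only [DetAlg.state, A.hist_congr p h _ ht]

theorem cost_succ [MetricSpace M] (ℓ : ℕ → CostFn M) (T : ℕ) (y : ℕ → M) :
    cost ℓ (T + 1) y = cost ℓ T y + (edist (y T) (y (T + 1)) + ℓ (T + 1) (y (T + 1))) :=
  Finset.sum_range_succ _ _

theorem cost_congr [MetricSpace M] {ℓ ℓ' : ℕ → CostFn M} {T : ℕ} {y y' : ℕ → M}
    (h : ∀ s ≤ T, ℓ s = ℓ' s) (hy : ∀ s ≤ T, y s = y' s) : cost ℓ T y = cost ℓ' T y' := by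
  refine Finset.sum_congr rfl fun t ht => ?_
  have ht := Finset.mem_range.1 ht
  rw [h (t + 1) ht, hy t ht.le, hy (t + 1) ht]

theorem RandAlg.expectedCost_congr [MetricSpace M] (R : RandAlg M) (x₀ : M)
    {ℓ ℓ' : ℕ → CostFn M} (p : ℕ → M) {T : ℕ} (h : ∀ s ≤ T, ℓ s = ℓ' s) :
    R.expectedCost x₀ ℓ p T = R.expectedCost x₀ ℓ' p T := by
  unfold RandAlg.expectedCost
  congr 1
  funext ω
  exact cost_congr h fun s hs => (R.alg ω).state_congr x₀ p h hs

/-- Superadditivity of the lower integral suffices for lower bounds and needs no measurability. -/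
theorem RandAlg.expectedCost_succ_ge [MetricSpace M] (R : RandAlg M) (x₀ : M)
    (ℓ : ℕ → CostFn M) (p : ℕ → M) (T : ℕ) :
    R.expectedCost x₀ ℓ p T + ∫⁻ ω, (edist ((R.alg ω).state x₀ ℓ p T)
        ((R.alg ω).state x₀ ℓ p (T + 1)) + ℓ (T + 1) ((R.alg ω).state x₀ ℓ p (T + 1))) ∂(R.μ) ≤
      R.expectedCost x₀ ℓ p (T + 1) := by
  simp only [RandAlg.expectedCost, cost_succ]
  exact le_lintegral_add _ _

theorem opt_le [MetricSpace M] {x₀ : M} (ℓ : ℕ → CostFn M) (T : ℕ) {y : ℕ → M} (hy : y 0 = x₀) :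
    opt x₀ ℓ T ≤ cost ℓ T y :=
  iInf₂_le y hy

theorem le_cost_of_one_le [MetricSpace M] {ℓ : ℕ → CostFn M} (h : ∀ t x, 1 ≤ ℓ t x) (T : ℕ)
    (y : ℕ → M) : (T : ℝ≥0∞) ≤ cost ℓ T y := by
  induction T with
  | zero => simp
  | succ T ih =>
    rw [cost_succ]
    push_cast
    exact add_le_add ih ((h _ _).trans le_add_self)

/-- The number of queries up to time `T` is at most `T / a + 1`. -/
theorem DetAlg.WellSeparated.card_queries_le {A : DetAlg M} {a : ℕ} (hA : A.WellSeparated a)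
    (ha : 1 ≤ a) (ℓ : ℕ → CostFn M) (p : ℕ → M) (T : ℕ) :
    a * ((Finset.range T).filter fun t => A.queried ℓ p (t + 1) = true).card ≤ T + a := by
  -- Separated queries lie in distinct blocks of length `a`.
  have hcard : ((Finset.range T).filter fun t => A.queried ℓ p (t + 1) = true).card ≤
      (Finset.range (T / a + 1)).card := by
    refine Finset.card_le_card_of_injOn (fun t => t / a) (fun t ht => ?_) ?_
    · simp only [Finset.coe_filter, Finset.mem_range, Set.mem_ofPred_eq] at ht
      simpa using Nat.lt_succ_of_le (Nat.div_le_div_right ht.1.le)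
    · have key : ∀ s t, s < t → A.queried ℓ p (s + 1) = true → A.queried ℓ p (t + 1) = true →
          s / a ≠ t / a := by
        intro s t hst hs ht
        have h1 := hA ℓ p (s + 1) (t + 1) (by omega) hs ht
        have h2 : (s + a) / a ≤ t / a := Nat.div_le_div_right (by omega)
        rw [Nat.add_div_right _ ha] at h2
        omega
      intro s hs t ht hst
      simp only [Finset.coe_filter, Set.mem_ofPred_eq] at hs ht
      rcases lt_trichotomy s t with h | h | h
      · exact absurd hst (key s t h hs.2 ht.2)
      · exact h
      · exact absurd hst.symm (key t s h ht.2 hs.2)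
  rw [Finset.card_range] at hcard
  calc _ ≤ a * (T / a + 1) := Nat.mul_le_mul_left _ hcard
    _ ≤ T + a := by rw [mul_add, mul_one]; exact Nat.add_le_add_right (Nat.mul_div_le T a) a

end General

/-! ### The adversary. -/

section Uniform

variable {n : ℕ}

theorem UniformMetric.edist_eq (x y : UniformMetric n) : edist x y = if x = y then 0 else 1 := by
  rw [edist_dist]
  change ENNReal.ofReal (if x = y then 0 else 1) = _
  split_ifs <;> simp

theorem UniformMetric.edist_le_one (x y : UniformMetric n) : edist x y ≤ 1 := by
  rw [UniformMetric.edist_eq]; split_ifs <;> simp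

theorem UniformMetric.edist_of_ne {x y : UniformMetric n} (h : x ≠ y) : edist x y = 1 := by
  rw [UniformMetric.edist_eq, if_neg h]

theorem UniformMetric.card : Fintype.card (UniformMetric n) = n := Fintype.card_fin n

/-- The tasks of a phase: every task costs `1` outside of a set of survivors, which shrinks
according to `m`, and the algorithm pays at least `q` in expectation for each task. -/
theorem RandAlg.exists_phase_prefix (R : RandAlg (UniformMetric n)) (x₀ : UniformMetric n)
    (p : ℕ → UniformMetric n) {q : ℝ≥0∞} {m : ℕ → ℕ}
    (hm : ∀ ℓ t j (S : Finset (UniformMetric n)), m (j + 1) ≤ S.card →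
      ∃ S' ⊆ S, m j ≤ S'.card ∧ q ≤ R.μ {ω | (R.alg ω).state x₀ ℓ p t ∉ S'})
    {k : ℕ} (hk : m k ≤ n) (ℓ : ℕ → CostFn (UniformMetric n)) (T : ℕ) :
    ∀ i ≤ k, ∃ (ℓ' : ℕ → CostFn (UniformMetric n)) (S : Finset (UniformMetric n)),
      (∀ s ≤ T, ℓ' s = ℓ s) ∧ m (k - i) ≤ S.card ∧
      (∀ s, T < s → s ≤ T + i → ∀ x ∈ S, ℓ' s x = 0) ∧
      R.expectedCost x₀ ℓ p T + i * q ≤ R.expectedCost x₀ ℓ' p (T + i) := by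
  intro i
  induction i with
  | zero =>
    intro _
    refine ⟨ℓ, Finset.univ, fun _ _ => rfl, ?_, fun s h1 h2 => by omega, by simp⟩
    simpa [UniformMetric.card] using hk
  | succ i ih =>
    intro hi
    obtain ⟨ℓ₁, S, h1, h2, h3, h4⟩ := ih (by omega)
    rw [show k - i = (k - (i + 1)) + 1 by omega] at h2
    obtain ⟨S', hS', hcard, hq⟩ := hm ℓ₁ (T + i) _ S h2
    set ℓ₂ := Function.update ℓ₁ (T + i + 1) (fun x => if x ∈ S' then 0 else 1) with hℓ₂
    have hagree : ∀ s ≤ T + i, ℓ₂ s = ℓ₁ s := fun s hs =>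
      Function.update_of_ne (by omega) _ _
    have hlast : ℓ₂ (T + i + 1) = fun x => if x ∈ S' then 0 else 1 := Function.update_self ..
    refine ⟨ℓ₂, S', fun s hs => (hagree s (by omega)).trans (h1 s hs), hcard, ?_, ?_⟩
    · intro s hs1 hs2 x hx
      by_cases hs : s = T + i + 1
      · rw [hs, hlast]; simp [hx]
      · rw [hagree s (by omega)]
        exact h3 s hs1 (by omega) x (hS' hx)
    · refine le_trans ?_ (R.expectedCost_succ_ge x₀ ℓ₂ p (T + i))
      rw [R.expectedCost_congr x₀ p hagree]
      -- A run outside `S'` before the task either enters `S'`, at distance `1`, or is charged `1`.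
      have hstep : q ≤ ∫⁻ ω, (edist ((R.alg ω).state x₀ ℓ₂ p (T + i))
          ((R.alg ω).state x₀ ℓ₂ p (T + i + 1)) +
          ℓ₂ (T + i + 1) ((R.alg ω).state x₀ ℓ₂ p (T + i + 1))) ∂(R.μ) := by
        have hmeas : MeasurableSet {ω | (R.alg ω).state x₀ ℓ₁ p (T + i) ∉ S'} :=
          R.measurable_state x₀ ℓ₁ p (T + i) {x | x ∉ S'}
        refine hq.trans ?_
        rw [← lintegral_indicator_one hmeas]
        refine lintegral_mono fun ω => ?_
        rw [(R.alg ω).state_congr x₀ p hagree le_rfl, hlast]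
        by_cases hω : (R.alg ω).state x₀ ℓ₁ p (T + i) ∈ S'
        · simp [hω]
        · simp only [Set.indicator, Set.mem_ofPred_eq, hω, not_false_eq_true, if_true,
            Pi.one_apply]
          split_ifs with h'
          · rw [UniformMetric.edist_of_ne (ne_of_mem_of_not_mem h' hω).symm]; simp
          · exact le_add_self
      push_cast
      calc R.expectedCost x₀ ℓ p T + (i + 1) * q
          = (R.expectedCost x₀ ℓ p T + i * q) + q := by rw [add_mul, one_mul, add_assoc]
        _ ≤ _ := add_le_add h4 hstep

/-- An instance on which the expected cost of the algorithm is large compared to the optimum. -/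
theorem RandAlg.exists_hard_instance (R : RandAlg (UniformMetric n)) (x₀ : UniformMetric n)
    (p : ℕ → UniformMetric n) {q : ℝ≥0∞} {m : ℕ → ℕ} (hm0 : 1 ≤ m 0)
    (hm : ∀ ℓ t j (S : Finset (UniformMetric n)), m (j + 1) ≤ S.card →
      ∃ S' ⊆ S, m j ≤ S'.card ∧ q ≤ R.μ {ω | (R.alg ω).state x₀ ℓ p t ∉ S'})
    {k : ℕ} (hk : m k ≤ n) (N : ℕ) :
    ∃ ℓ : ℕ → CostFn (UniformMetric n),
      (N : ℝ≥0∞) ≤ opt x₀ ℓ (N * (k + 1)) ∧ opt x₀ ℓ (N * (k + 1)) ≤ 2 * N ∧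
      N * (k * q + 1) ≤ R.expectedCost x₀ ℓ p (N * (k + 1)) := by
  suffices h : ∃ ℓ : ℕ → CostFn (UniformMetric n),
      (∀ y, (N : ℝ≥0∞) ≤ cost ℓ (N * (k + 1)) y) ∧
      (∃ y, y 0 = x₀ ∧ cost ℓ (N * (k + 1)) y ≤ 2 * N) ∧
      N * (k * q + 1) ≤ R.expectedCost x₀ ℓ p (N * (k + 1)) by
    obtain ⟨ℓ, h1, ⟨y, hy, h2⟩, h3⟩ := h
    exact ⟨ℓ, le_iInf₂ fun y _ => h1 y, (opt_le ℓ _ hy).trans h2, h3⟩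
  induction N with
  | zero => exact ⟨fun _ _ => 0, by simp, ⟨fun _ => x₀, rfl, by simp [cost]⟩, by simp⟩
  | succ N ih =>
    obtain ⟨ℓ, h1, ⟨y, hy, h2⟩, h3⟩ := ih
    set T := N * (k + 1) with hT
    obtain ⟨ℓ₁, S, g1, g2, g3, g4⟩ := R.exists_phase_prefix x₀ p hm hk ℓ T k le_rfl
    rw [Nat.sub_self] at g2
    obtain ⟨s, hs⟩ := Finset.card_pos.1 (hm0.trans g2)
    have hTk : (N + 1) * (k + 1) = T + k + 1 := by rw [hT]; ring
    rw [hTk]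
    -- The closing task makes every solution pay at least `1` per phase; the error budget relies on
    -- this lower bound for `OPT`.
    set ℓ₂ := Function.update ℓ₁ (T + k + 1) (fun _ => 1) with hℓ₂
    have hagree : ∀ t ≤ T + k, ℓ₂ t = ℓ₁ t := fun t ht => Function.update_of_ne (by omega) _ _
    have hlast : ℓ₂ (T + k + 1) = fun _ => 1 := Function.update_self ..
    have hagree' : ∀ t ≤ T, ℓ₂ t = ℓ t := fun t ht => (hagree t (by omega)).trans (g1 t ht)
    refine ⟨ℓ₂, fun z => ?_, ⟨fun t => if t ≤ T then y t else s, by simp [hy], ?_⟩, ?_⟩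
    · rw [cost_succ, hlast]
      push_cast
      refine add_le_add ?_ le_add_self
      calc (N : ℝ≥0∞) ≤ cost ℓ T z := h1 z
        _ = cost ℓ₂ T z := (cost_congr hagree' fun _ _ => rfl).symm
        _ ≤ _ := Finset.sum_le_sum_of_subset (by
            intro t ht; simp only [Finset.mem_range] at ht ⊢; omega)
    · have hbase : cost ℓ₂ T (fun t => if t ≤ T then y t else s) = cost ℓ T y :=
        cost_congr hagree' fun t ht => by simp [ht]
      set y' : ℕ → UniformMetric n := fun t => if t ≤ T then y t else s with hy'
      have hs' : ∀ t, T < t → y' t = s := fun t ht => if_neg (by omega)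
      -- The distance term reserves the single move to the final survivor `s`, which pays nothing
      -- before the closing task.
      have hstep : ∀ i ≤ k, cost ℓ₂ (T + i) y' + edist (y' (T + i)) s ≤ cost ℓ T y + 1 := by
        intro i
        induction i with
        | zero => exact fun _ => add_le_add hbase.le (UniformMetric.edist_le_one _ _)
        | succ i ih =>
          intro hi
          rw [← add_assoc, cost_succ, hs' (T + i + 1) (by omega), edist_self, add_zero,
            hagree _ (by omega), g3 (T + i + 1) (by omega) (by omega) s hs, add_zero]
          exact ih (by omega)
      rw [cost_succ, hs' (T + k + 1) (by omega), hlast, ← add_assoc]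
      push_cast
      calc _ ≤ cost ℓ T y + 1 + 1 := add_le_add (hstep k le_rfl) le_rfl
        _ ≤ 2 * N + 1 + 1 := by gcongr
        _ = 2 * (N + 1) := by ring
    · refine le_trans ?_ (R.expectedCost_succ_ge x₀ ℓ₂ p (T + k))
      rw [R.expectedCost_congr x₀ p hagree, hlast]
      have hone : (1 : ℝ≥0∞) ≤ ∫⁻ ω, (edist ((R.alg ω).state x₀ ℓ₂ p (T + k))
          ((R.alg ω).state x₀ ℓ₂ p (T + k + 1)) + 1) ∂(R.μ) := by
        calc (1 : ℝ≥0∞) = ∫⁻ _, 1 ∂(R.μ) := by simp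
          _ ≤ _ := lintegral_mono fun ω => le_add_self
      push_cast
      calc ((N : ℝ≥0∞) + 1) * (k * q + 1) = (N * (k * q + 1) + k * q) + 1 := by ring
        _ ≤ _ := add_le_add ((add_le_add_left h3 _).trans g4) hone

end Uniform

/-! ### From hard instances to competitive ratios. -/

theorem le_of_forall_nat_mul_le {X : ℝ≥0∞} {Y κ : ℝ≥0} {N₀ : ℕ}
    (h : ∀ N : ℕ, N₀ ≤ N → (N : ℝ≥0∞) * X ≤ N * Y + κ) : X ≤ Y := by
  refine ENNReal.le_of_forall_pos_le_add fun ε hε _ => ?_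
  obtain ⟨N, hN⟩ := exists_nat_ge (κ / ε)
  -- Using `N₀ + 1` also makes the multiplier nonzero, so that it can be cancelled.
  have hκ : κ ≤ (max (N₀ + 1) N : ℕ) * ε := by
    rw [← div_le_iff₀ hε]
    exact hN.trans (by exact_mod_cast le_max_right _ _)
  have h1 := h (max (N₀ + 1) N) (le_trans (Nat.le_succ _) (le_max_left _ _))
  generalize hK : max (N₀ + 1) N = K at *
  have hK0 : (K : ℝ≥0∞) ≠ 0 := by
    have : N₀ + 1 ≤ K := hK ▸ le_max_left _ _
    simp only [ne_eq, Nat.cast_eq_zero]; omega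
  rw [← ENNReal.mul_le_mul_iff_right hK0 (ENNReal.natCast_ne_top K), mul_add]
  refine h1.trans (add_le_add le_rfl ?_)
  exact_mod_cast hκ

section Uniform

variable {n : ℕ} {x₀ : UniformMetric n}

theorem DetAlg.exists_survivors (A : DetAlg (UniformMetric n)) (x₀ : UniformMetric n)
    (p : ℕ → UniformMetric n) (ℓ : ℕ → CostFn (UniformMetric n)) (t j : ℕ)
    (S : Finset (UniformMetric n)) (hS : j + 1 + 1 ≤ S.card) :
    ∃ S' ⊆ S, j + 1 ≤ S'.card ∧
      1 ≤ A.toRand.μ {ω | (A.toRand.alg ω).state x₀ ℓ p t ∉ S'} := by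
  refine ⟨S.erase (A.state x₀ ℓ p t), Finset.erase_subset _ _, ?_, ?_⟩
  · have := Finset.pred_card_le_card_erase (s := S) (a := A.state x₀ ℓ p t)
    omega
  · have : {ω | (A.toRand.alg ω).state x₀ ℓ p t ∉ S.erase (A.state x₀ ℓ p t)} = Set.univ := by
      ext ω
      simp [DetAlg.toRand]
    rw [this, measure_univ]

/-- Split `S` into two disjoint parts. The state is always outside at least one of them, so for one
part this has probability at least `1/2`. -/
theorem RandAlg.exists_survivors (R : RandAlg (UniformMetric n)) (x₀ : UniformMetric n)
    (p : ℕ → UniformMetric n) (ℓ : ℕ → CostFn (UniformMetric n)) (t j : ℕ)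
    (S : Finset (UniformMetric n)) (hS : 2 ^ (j + 1) ≤ S.card) :
    ∃ S' ⊆ S, 2 ^ j ≤ S'.card ∧ (2⁻¹ : ℝ≥0∞) ≤ R.μ {ω | (R.alg ω).state x₀ ℓ p t ∉ S'} := by
  rw [pow_succ] at hS
  obtain ⟨S₁, hS₁, hcard⟩ := Finset.exists_subset_card_eq (s := S) (n := 2 ^ j) (by omega)
  by_cases h : (2⁻¹ : ℝ≥0∞) ≤ R.μ {ω | (R.alg ω).state x₀ ℓ p t ∉ S₁}
  · exact ⟨S₁, hS₁, hcard.ge, h⟩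
  refine ⟨S \ S₁, Finset.sdiff_subset, ?_, ?_⟩
  · rw [Finset.card_sdiff_of_subset hS₁]; omega
  have hmeas : MeasurableSet {ω | (R.alg ω).state x₀ ℓ p t ∉ S₁} :=
    R.measurable_state x₀ ℓ p t {x | x ∉ S₁}
  have hsum := measure_add_measure_compl (μ := R.μ) hmeas
  rw [measure_univ] at hsum
  have hle : (2⁻¹ : ℝ≥0∞) ≤ R.μ {ω | (R.alg ω).state x₀ ℓ p t ∉ S₁}ᶜ := by
    by_contra hlt
    have := ENNReal.add_lt_add (not_le.1 h) (not_le.1 hlt)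
    rw [hsum, ENNReal.inv_two_add_inv_two] at this
    exact lt_irrefl _ this
  refine hle.trans (measure_mono fun ω hω => ?_)
  simp only [Set.mem_compl_iff, Set.mem_ofPred_eq, not_not] at hω
  simp [hω]

/-- Adversarial selection of survivors: `m j` of at least `m (j + 1)` states can be chosen to
survive such that the algorithm is outside of them with probability at least `q`. -/
def RandAlg.Vulnerable (R : RandAlg (UniformMetric n)) (x₀ : UniformMetric n) (m : ℕ → ℕ)
    (q : ℝ≥0) : Prop :=
  1 ≤ m 0 ∧ ∀ (p : ℕ → UniformMetric n) ℓ t j (S : Finset (UniformMetric n)), m (j + 1) ≤ S.card →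
    ∃ S' ⊆ S, m j ≤ S'.card ∧ (q : ℝ≥0∞) ≤ R.μ {ω | (R.alg ω).state x₀ ℓ p t ∉ S'}

theorem DetAlg.vulnerable (A : DetAlg (UniformMetric n)) (x₀ : UniformMetric n) :
    A.toRand.Vulnerable x₀ (· + 1) 1 :=
  ⟨le_rfl, A.exists_survivors x₀⟩

theorem RandAlg.vulnerable (R : RandAlg (UniformMetric n)) (x₀ : UniformMetric n) :
    R.Vulnerable x₀ (2 ^ ·) 2⁻¹ :=
  ⟨le_rfl, by simpa using R.exists_survivors x₀⟩

theorem RandAlg.IsCompetitive.le_of_vulnerable {R : RandAlg (UniformMetric n)} {r : ℝ≥0}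
    (hR : R.IsCompetitive x₀ r) {m : ℕ → ℕ} {q : ℝ≥0} (hm : R.Vulnerable x₀ m q) {k : ℕ}
    (hk : m k ≤ n) : k * q + 1 ≤ 2 * r := by
  obtain ⟨κ, hκ⟩ := hR
  have key : ((k * q + 1 : ℝ≥0) : ℝ≥0∞) ≤ (2 * r : ℝ≥0) := by
    refine le_of_forall_nat_mul_le (N₀ := 0) (κ := κ) fun N _ => ?_
    obtain ⟨ℓ, -, h2, h3⟩ := R.exists_hard_instance x₀ (fun _ => x₀) hm.1 (hm.2 _) hk N
    push_cast
    refine h3.trans ((hκ _ _ _).trans (add_le_add ?_ le_rfl))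
    calc (r : ℝ≥0∞) * _ ≤ r * (2 * N) := by gcongr
      _ = _ := by ring
  exact_mod_cast key

theorem DetAlg.predError_le (A : DetAlg (UniformMetric n)) {a : ℕ} (hA : A.WellSeparated a)
    (ha : 1 ≤ a) (ℓ : ℕ → CostFn (UniformMetric n)) (p : ℕ → UniformMetric n) (T : ℕ)
    (o : ℕ → UniformMetric n) : a * A.predError ℓ p T o ≤ T + a := by
  have h : A.predError ℓ p T o ≤
      ((Finset.range T).filter fun t => A.queried ℓ p (t + 1) = true).card := by
    rw [DetAlg.predError, ← Finset.sum_filter]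
    refine (Finset.sum_le_card_nsmul _ _ 1 fun t _ => UniformMetric.edist_le_one _ _).trans ?_
    simp
  exact (mul_le_mul' le_rfl h).trans (by exact_mod_cast hA.card_queries_le ha ℓ p T)

/-- Spacing of the queries alone keeps the error within budget on the hard instance, in every
outcome. The strict gap in `hka` absorbs the one extra query in `T / a + 1` once there are enough
phases. -/
theorem RandAlg.IsCompetitiveWithError.le_of_vulnerable {R : RandAlg (UniformMetric n)}
    {off : OptimalOffline x₀} {ρ r : ℝ≥0} (hR : R.IsCompetitiveWithError x₀ off ρ r) {a : ℕ}
    (ha : 1 ≤ a) (hsep : R.WellSeparated a) {m : ℕ → ℕ} {q : ℝ≥0} (hm : R.Vulnerable x₀ m q)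
    {k : ℕ} (hk : m k ≤ n) (hka : (k + 1 : ℝ≥0) < a * ρ) : k * q + 1 ≤ 2 * r := by
  obtain ⟨κ, hκ⟩ := hR
  obtain ⟨δ, hδ⟩ := exists_add_of_le hka.le
  have hδ0 : 0 < δ := by
    rw [pos_iff_ne_zero]
    rintro rfl
    rw [hδ, add_zero] at hka
    exact lt_irrefl _ hka
  obtain ⟨N₀, hN₀⟩ := exists_nat_ge (a / δ)
  rw [div_le_iff₀ hδ0] at hN₀
  have key : ((k * q + 1 : ℝ≥0) : ℝ≥0∞) ≤ (2 * r : ℝ≥0) := by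
    refine le_of_forall_nat_mul_le (N₀ := N₀) (κ := κ) fun N hN => ?_
    obtain ⟨ℓ, h1, h2, h3⟩ := R.exists_hard_instance x₀ (fun _ => x₀) hm.1 (hm.2 _) hk N
    push_cast
    refine h3.trans ((hκ ℓ _ _ (ae_of_all _ fun ω => ?_)).trans (add_le_add ?_ le_rfl))
    · have ha0 : (a : ℝ≥0∞) ≠ 0 := by simp only [ne_eq, Nat.cast_eq_zero]; omega
      rw [← ENNReal.mul_le_mul_iff_right ha0 (ENNReal.natCast_ne_top a)]
      have hle : ((N * (k + 1) : ℕ) : ℝ≥0) + a ≤ a * (ρ * N) := by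
        have : (a : ℝ≥0) ≤ N * δ := hN₀.trans (by gcongr)
        calc ((N * (k + 1) : ℕ) : ℝ≥0) + a ≤ N * (k + 1) + N * δ := by push_cast; gcongr
          _ = (k + 1 + δ) * N := by ring
          _ = _ := by rw [← hδ]; ring
      calc _ ≤ (((N * (k + 1) : ℕ) : ℝ≥0∞) + a) := (R.alg ω).predError_le (hsep ω) ha _ _ _ _
        _ ≤ a * (ρ * N) := by exact_mod_cast hle
        _ ≤ _ := by gcongr
    · calc (r : ℝ≥0∞) * _ ≤ r * (2 * N) := by gcongr
        _ = _ := by ring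
  exact_mod_cast key

/-- Let all tasks be constantly `1` and let the predictor report `off` itself: the error is `0`, so
this covers `ρ = 0`. -/
theorem RandAlg.IsCompetitiveWithError.one_le {R : RandAlg (UniformMetric n)}
    {off : OptimalOffline x₀} {ρ r : ℝ≥0} (hR : R.IsCompetitiveWithError x₀ off ρ r) :
    1 ≤ r := by
  obtain ⟨κ, hκ⟩ := hR
  have key : (1 : ℝ≥0∞) ≤ r := by
    refine le_of_forall_nat_mul_le (N₀ := 0) (κ := κ) fun N _ => ?_
    have h1 := hκ (fun _ _ => 1) (off.sol (fun _ _ => 1) N) N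
      (ae_of_all _ fun ω => by simp [DetAlg.predError])
    have h2 : (N : ℝ≥0∞) ≤ R.expectedCost x₀ (fun _ _ => 1) (off.sol (fun _ _ => 1) N) N := by
      calc (N : ℝ≥0∞) = ∫⁻ _, (N : ℝ≥0∞) ∂(R.μ) := by simp
        _ ≤ _ := lintegral_mono fun ω => le_cost_of_one_le (fun _ _ => le_rfl) _ _
    have h3 : opt x₀ (fun _ _ => 1) N ≤ (N : ℝ≥0∞) :=
      (opt_le (y := fun _ => x₀) _ _ rfl).trans (by simp [cost])
    rw [mul_one, mul_comm]
    exact h2.trans (h1.trans (by gcongr))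
  exact_mod_cast key

end Uniform

/-! ### The marking algorithm and random orders. -/

section Marking

variable {n : ℕ}

/-- The element of `U` that comes first in the order given by `e`. -/
noncomputable def firstIn (x₀ : UniformMetric n) (e : UniformMetric n ≃ Fin n)
    (U : Finset (UniformMetric n)) : UniformMetric n :=
  if h : U.Nonempty then (U.exists_min_image e h).choose else x₀

theorem firstIn_mem (x₀ : UniformMetric n) (e : UniformMetric n ≃ Fin n)
    {U : Finset (UniformMetric n)} (h : U.Nonempty) : firstIn x₀ e U ∈ U := by
  rw [firstIn, dif_pos h]
  exact (U.exists_min_image e h).choose_spec.1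

theorem firstIn_le (x₀ : UniformMetric n) (e : UniformMetric n ≃ Fin n)
    {U : Finset (UniformMetric n)} {y : UniformMetric n} (hy : y ∈ U) :
    e (firstIn x₀ e U) ≤ e y := by
  rw [firstIn, dif_pos ⟨y, hy⟩]
  exact (U.exists_min_image e ⟨y, hy⟩).choose_spec.2 y hy

theorem firstIn_eq_iff (x₀ : UniformMetric n) (e : UniformMetric n ≃ Fin n)
    {U : Finset (UniformMetric n)} {x : UniformMetric n} (hx : x ∈ U) :
    firstIn x₀ e U = x ↔ ∀ y ∈ U, e x ≤ e y := by
  refine ⟨fun h y hy => h ▸ firstIn_le x₀ e hy, fun h => e.injective (le_antisymm ?_ ?_)⟩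
  · exact firstIn_le x₀ e hx
  · exact h _ (firstIn_mem x₀ e ⟨x, hx⟩)

/-- The target moves only when it becomes saturated itself. -/
theorem firstIn_of_subset (x₀ : UniformMetric n) (e : UniformMetric n ≃ Fin n)
    {U U' : Finset (UniformMetric n)} (hU : U' ⊆ U) (h : firstIn x₀ e U ∈ U') :
    firstIn x₀ e U' = firstIn x₀ e U :=
  (firstIn_eq_iff x₀ e h).2 fun _ hy => firstIn_le x₀ e (hU hy)

/-- In a uniformly random order, each element of `U` comes first with the same probability. -/
theorem card_mul_card_firstIn (x₀ : UniformMetric n) {U : Finset (UniformMetric n)}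
    {x : UniformMetric n} (hx : x ∈ U) :
    U.card * (Finset.univ.filter fun e : UniformMetric n ≃ Fin n => firstIn x₀ e U = x).card =
      Fintype.card (UniformMetric n ≃ Fin n) := by
  -- Precomposing an order with the transposition of `x` and `y` exchanges the two events.
  have hswap : ∀ y ∈ U,
      (Finset.univ.filter fun e : UniformMetric n ≃ Fin n => firstIn x₀ e U = y).card =
      (Finset.univ.filter fun e : UniformMetric n ≃ Fin n => firstIn x₀ e U = x).card := by
    intro y hy
    have hmem : ∀ z ∈ U, Equiv.swap x y z ∈ U := by
      intro z hz
      rw [Equiv.swap_apply_def]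
      split_ifs <;> assumption
    refine Finset.card_bij' (fun e _ => (Equiv.swap x y).trans e)
      (fun e _ => (Equiv.swap x y).trans e) ?_ ?_ ?_ ?_
    · intro e he
      simp only [Finset.mem_filter, Finset.mem_univ, true_and] at he ⊢
      rw [firstIn_eq_iff x₀ _ hy] at he
      rw [firstIn_eq_iff x₀ _ hx]
      intro z hz
      simpa using he _ (hmem z hz)
    · intro e he
      simp only [Finset.mem_filter, Finset.mem_univ, true_and] at he ⊢
      rw [firstIn_eq_iff x₀ _ hx] at he
      rw [firstIn_eq_iff x₀ _ hy]
      intro z hz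
      simpa using he _ (hmem z hz)
    · intro e _; exact Equiv.ext fun z => congrArg e (Equiv.swap_apply_self x y z)
    · intro e _; exact Equiv.ext fun z => congrArg e (Equiv.swap_apply_self x y z)
  rw [← smul_eq_mul, ← Finset.sum_const, ← Finset.sum_congr rfl hswap, ← Finset.card_univ]
  exact (Finset.card_eq_sum_card_fiberwise fun e _ => firstIn_mem x₀ e ⟨x, hx⟩).symm

/-- The states on which less than cost `1` has accumulated. -/
noncomputable def unsaturated (W : CostFn (UniformMetric n)) : Finset (UniformMetric n) :=
  open Classical in Finset.univ.filter fun x => W x < 1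

theorem mem_unsaturated {W : CostFn (UniformMetric n)} {x : UniformMetric n} :
    x ∈ unsaturated W ↔ W x < 1 := by
  simp [unsaturated]

theorem unsaturated_zero : unsaturated (0 : CostFn (UniformMetric n)) = Finset.univ := by
  ext x; simp [mem_unsaturated]

theorem unsaturated_add_subset (W c : CostFn (UniformMetric n)) :
    unsaturated (W + c) ⊆ unsaturated W := fun _ hx =>
  mem_unsaturated.2 (le_self_add.trans_lt (mem_unsaturated.1 hx))

theorem exists_cheapest (x₀ : UniformMetric n) (c : CostFn (UniformMetric n)) :
    ∃ z, ∀ y, c z ≤ c y := by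
  obtain ⟨z, -, hz⟩ := Finset.exists_min_image Finset.univ c ⟨x₀, Finset.mem_univ _⟩
  exact ⟨z, fun y => hz y (Finset.mem_univ _)⟩

/-- The costs accumulated in the current phase, which ends when every state is saturated. -/
noncomputable def phaseStep (W c : CostFn (UniformMetric n)) : CostFn (UniformMetric n) :=
  open Classical in if (unsaturated (W + c)).Nonempty then W + c else 0

/-- The state chosen by the marking algorithm when the task `c` arrives. -/
noncomputable def markingMove (x₀ : UniformMetric n) (e : UniformMetric n ≃ Fin n)
    (W c : CostFn (UniformMetric n)) : UniformMetric n :=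
  open Classical in if (unsaturated (W + c)).Nonempty then firstIn x₀ e (unsaturated (W + c))
  else (exists_cheapest x₀ c).choose

/-- The marking algorithm of Borodin, Linial and Saks: go to the unsaturated state that comes first
in the order `e`, and to a cheapest state when a phase ends. -/
noncomputable def markingAlg (x₀ : UniformMetric n) (e : UniformMetric n ≃ Fin n) :
    DetAlg (UniformMetric n) where
  query _ _ := false
  move h := ((h.map Prod.fst).foldl
    (fun s c => (phaseStep s.1 c, markingMove x₀ e s.1 c)) (0, x₀)).2

/-- The costs accumulated after `t` steps in the current phase. -/
noncomputable def phaseCost (ℓ : ℕ → CostFn (UniformMetric n)) : ℕ → CostFn (UniformMetric n)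
  | 0 => 0
  | t + 1 => phaseStep (phaseCost ℓ t) (ℓ (t + 1))

/-- The accumulated costs depend neither on `e` nor on the predictor, so only the choice of the
first element is random. -/
theorem markingAlg_foldl (x₀ : UniformMetric n) (e : UniformMetric n ≃ Fin n)
    (ℓ : ℕ → CostFn (UniformMetric n)) (p : ℕ → UniformMetric n) (t : ℕ) :
    ((((markingAlg x₀ e).hist ℓ p t).map Prod.fst).foldl
      (fun s c => (phaseStep s.1 c, markingMove x₀ e s.1 c)) (0, x₀)).1 = phaseCost ℓ t := by
  induction t with
  | zero => rfl
  | succ t ih => simp [DetAlg.hist, List.foldl_append, ih, phaseCost]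

theorem markingAlg_state_succ (x₀ : UniformMetric n) (e : UniformMetric n ≃ Fin n)
    (ℓ : ℕ → CostFn (UniformMetric n)) (p : ℕ → UniformMetric n) (t : ℕ) :
    (markingAlg x₀ e).state x₀ ℓ p (t + 1) = markingMove x₀ e (phaseCost ℓ t) (ℓ (t + 1)) := by
  rw [← markingAlg_foldl x₀ e ℓ p t]
  simp [DetAlg.state, DetAlg.hist, List.foldl_append, markingAlg]

/-! ### Potential estimates. -/

section Potential

variable {Ω : Type} [MeasurableSpace Ω] {μ : Measure Ω}
  {e : Ω → UniformMetric n ≃ Fin n} {x₀ : UniformMetric n} {β : ℕ → ℝ≥0}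

/-- Here `β u` bounds the probability that a given one of `u` unsaturated states comes first: `1`
for a fixed order, `1 / u` for a random one. This treats both algorithms at once. -/
theorem lintegral_firstIn_le (hmeas : ∀ s : Set Ω, MeasurableSet s)
    (hβ : ∀ (U : Finset (UniformMetric n)), ∀ x ∈ U, μ {ω | firstIn x₀ (e ω) U = x} ≤ β U.card)
    {U : Finset (UniformMetric n)} (hU : U.Nonempty) (g : UniformMetric n → ℝ≥0∞) :
    ∫⁻ ω, g (firstIn x₀ (e ω) U) ∂μ ≤ β U.card * ∑ x ∈ U, g x := by
  have h : ∀ ω, g (firstIn x₀ (e ω) U) =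
      ∑ x ∈ U, {ω | firstIn x₀ (e ω) U = x}.indicator (fun _ => g x) ω := by
    intro ω
    simp only [Set.indicator, Set.mem_ofPred_eq]
    rw [Finset.sum_ite_eq, if_pos (firstIn_mem x₀ (e ω) hU)]
  simp only [h]
  rw [lintegral_finsetSum _ fun x _ => measurable_const.indicator (hmeas _), Finset.mul_sum]
  refine Finset.sum_le_sum fun x hx => ?_
  rw [lintegral_indicator_const (hmeas _), mul_comm]
  exact mul_le_mul' (hβ U x hx) le_rfl

theorem lintegral_edist_firstIn_le (hmeas : ∀ s : Set Ω, MeasurableSet s)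
    (hβ : ∀ (U : Finset (UniformMetric n)), ∀ x ∈ U, μ {ω | firstIn x₀ (e ω) U = x} ≤ β U.card)
    {U U' : Finset (UniformMetric n)} (hU : U.Nonempty) (hU' : U' ⊆ U) :
    ∫⁻ ω, edist (firstIn x₀ (e ω) U) (firstIn x₀ (e ω) U') ∂μ ≤ β U.card * (U \ U').card := by
  calc _ ≤ ∫⁻ ω, (fun x => if x ∈ U' then 0 else 1) (firstIn x₀ (e ω) U) ∂μ := by
        refine lintegral_mono fun ω => ?_
        by_cases h : firstIn x₀ (e ω) U ∈ U'
        · simp [firstIn_of_subset x₀ (e ω) hU' h]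
        · simpa [h] using UniformMetric.edist_le_one _ _
    _ ≤ β U.card * ∑ x ∈ U, if x ∈ U' then 0 else 1 :=
        lintegral_firstIn_le hmeas hβ hU _
    _ = _ := by
        congr 1
        rw [← Finset.sum_sdiff hU', Finset.sum_congr rfl (g := fun _ => 1),
          Finset.sum_eq_zero (s := U')]
        · simp
        · intro x hx; simp [hx]
        · intro x hx; simp [(Finset.mem_sdiff.1 hx).2]

/-- The sum of the first values of `β`. -/
noncomputable def partialSum (β : ℕ → ℝ≥0) (u : ℕ) : ℝ≥0 := ∑ i ∈ Finset.range u, β (i + 1)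

/-- By monotonicity each of the last `d` summands is at least `β (u + d)`. -/
theorem mul_add_partialSum_le (hanti : ∀ i j, 1 ≤ i → i ≤ j → β j ≤ β i) (u d : ℕ) :
    β (u + d) * d + partialSum β u ≤ partialSum β (u + d) := by
  rw [partialSum, partialSum, Finset.sum_range_add, add_comm]
  gcongr
  have hsum : (Finset.range d).card • β (u + d) ≤ ∑ x ∈ Finset.range d, β (u + x + 1) := by
    refine Finset.card_nsmul_le_sum _ _ _ fun i hi => ?_
    have := Finset.mem_range.1 hi
    exact hanti _ _ (by omega) (by omega)
  rwa [Finset.card_range, nsmul_eq_mul, mul_comm] at hsum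

/-- The cost of saturating the states of `U \ U'`, in terms of the potential. -/
theorem saturation_le (hanti : ∀ i j, 1 ≤ i → i ≤ j → β j ≤ β i)
    {U U' : Finset (UniformMetric n)} (hU' : U' ⊆ U) (hne : U'.Nonempty)
    {W : CostFn (UniformMetric n)} (hW : ∀ x ∈ U, W x ≤ 1) :
    partialSum β U'.card + β U.card * ∑ x ∈ U, W x ≤
      partialSum β U.card + (β U'.card : ℝ≥0∞) * ∑ x ∈ U', W x := by
  have hcard : U.card = U'.card + (U \ U').card := by
    rw [Finset.card_sdiff_of_subset hU', Nat.add_sub_cancel' (Finset.card_le_card hU')]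
  have h1 : (β U.card : ℝ≥0∞) * (U \ U').card + partialSum β U'.card ≤ partialSum β U.card := by
    have := mul_add_partialSum_le hanti U'.card (U \ U').card
    rw [← hcard] at this
    exact_mod_cast this
  have h2 : ∑ x ∈ U \ U', W x ≤ (U \ U').card := by
    refine (Finset.sum_le_card_nsmul _ _ 1 fun x hx => hW x (Finset.mem_sdiff.1 hx).1).trans ?_
    simp
  have h3 : (β U.card : ℝ≥0∞) ≤ β U'.card := by
    exact_mod_cast hanti _ _ (Finset.card_pos.2 hne) (Finset.card_le_card hU')
  rw [← Finset.sum_sdiff hU', mul_add]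
  calc (partialSum β U'.card : ℝ≥0∞) + (β U.card * ∑ x ∈ U \ U', W x + β U.card * ∑ x ∈ U', W x)
      ≤ partialSum β U'.card + (β U.card * (U \ U').card + β U'.card * ∑ x ∈ U', W x) := by gcongr
    _ = (β U.card * (U \ U').card + partialSum β U'.card) + β U'.card * ∑ x ∈ U', W x := by ring
    _ ≤ _ := by gcongr

end Potential

end Marking

/-! ### The invariant of the marking algorithm. -/

section Marking

variable {n : ℕ} {Ω : Type} [MeasurableSpace Ω] {μ : Measure Ω}
  {e : Ω → UniformMetric n ≃ Fin n} {x₀ : UniformMetric n} {β : ℕ → ℝ≥0}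

theorem sum_unsaturated_le_partialSum (hanti : ∀ i j, 1 ≤ i → i ≤ j → β j ≤ β i)
    (W : CostFn (UniformMetric n)) :
    β (unsaturated W).card * ∑ x ∈ unsaturated W, W x ≤ partialSum β (unsaturated W).card := by
  have h1 := mul_add_partialSum_le hanti 0 (unsaturated W).card
  rw [zero_add, partialSum, Finset.sum_range_zero, add_zero] at h1
  have h2 : ∑ x ∈ unsaturated W, W x ≤ (unsaturated W).card := by
    refine (Finset.sum_le_card_nsmul _ _ 1 fun x hx => (mem_unsaturated.1 hx).le).trans ?_
    simp
  exact (mul_le_mul' le_rfl h2).trans (by exact_mod_cast h1)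

/-- A solution that stays pays the increase of its accumulated cost; one that moves pays `1`, which
is already the cap. -/
theorem min_one_phase_le (W c : CostFn (UniformMetric n)) (x y : UniformMetric n) :
    min 1 (W y + c y) ≤ min 1 (W x) + (edist x y + c y) := by
  by_cases h : x = y
  · subst h
    rw [edist_self, zero_add, ← min_add_add_right]
    exact min_le_min le_self_add le_rfl
  · rw [UniformMetric.edist_of_ne h]
    exact (min_le_left _ _).trans (le_self_add.trans le_add_self)

variable [IsProbabilityMeasure μ]

/-- The potential is `2 * partialSum β u - β u * ∑ W`, written without subtraction. Within a phase,
one copy of `partialSum` pays for moves and the other, with the sum over `W`, for service. The term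
`min 1 (W (y t))` is credit from the offline solution: full at the end of a phase, it pays `2 *
partialSum β n` to refill the potential and `2` for moving to a cheapest state and on to the new
target. The extra `cost ℓ t y` in the coefficient pays for the task at that cheapest state. -/
theorem markingAlg_invariant (hmeas : ∀ s : Set Ω, MeasurableSet s)
    (hβ : ∀ (U : Finset (UniformMetric n)), ∀ x ∈ U, μ {ω | firstIn x₀ (e ω) U = x} ≤ β U.card)
    (hanti : ∀ i j, 1 ≤ i → i ≤ j → β j ≤ β i) (ℓ : ℕ → CostFn (UniformMetric n))
    (p y : ℕ → UniformMetric n) (t : ℕ) :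
    (∫⁻ ω, (cost ℓ t ((markingAlg x₀ (e ω)).state x₀ ℓ p) +
        edist ((markingAlg x₀ (e ω)).state x₀ ℓ p t)
          (firstIn x₀ (e ω) (unsaturated (phaseCost ℓ t)))) ∂μ) +
      2 * partialSum β (unsaturated (phaseCost ℓ t)).card +
      (2 * partialSum β n + 2) * min 1 (phaseCost ℓ t (y t)) ≤
    (2 * partialSum β n + 3) * cost ℓ t y + (2 * partialSum β n + 1) +
      β (unsaturated (phaseCost ℓ t)).card *
        ∑ x ∈ unsaturated (phaseCost ℓ t), phaseCost ℓ t x := by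
  have hmf : ∀ f : Ω → ℝ≥0∞, Measurable f := fun f s _ => hmeas _
  induction t with
  | zero =>
    have h : ∫⁻ ω, (cost ℓ 0 ((markingAlg x₀ (e ω)).state x₀ ℓ p) +
        edist ((markingAlg x₀ (e ω)).state x₀ ℓ p 0)
          (firstIn x₀ (e ω) (unsaturated (phaseCost ℓ 0)))) ∂μ ≤ 1 := by
      calc _ ≤ ∫⁻ _, 1 ∂μ := lintegral_mono fun ω => by
            simpa [cost] using UniformMetric.edist_le_one _ _
        _ = 1 := by simp
    have hcard : (unsaturated (phaseCost ℓ 0)).card = n := by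
      rw [phaseCost, unsaturated_zero, Finset.card_univ, UniformMetric.card]
    rw [hcard]
    simp only [phaseCost, Pi.zero_apply, zero_le, inf_of_le_right, mul_zero, add_zero,
      Finset.sum_const_zero]
    rw [add_comm]
    exact (add_le_add le_rfl h).trans le_add_self
  | succ t ih =>
    set W := phaseCost ℓ t with hW
    set c := ℓ (t + 1) with hc
    set B := partialSum β with hB
    set A := ∫⁻ ω, (cost ℓ t ((markingAlg x₀ (e ω)).state x₀ ℓ p) +
        edist ((markingAlg x₀ (e ω)).state x₀ ℓ p t) (firstIn x₀ (e ω) (unsaturated W))) ∂μ with hA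
    set K : ℝ≥0∞ := 2 * B n + 2 with hK
    have hK1 : (2 * B n + 3 : ℝ≥0∞) = K + 1 := by rw [hK]; ring
    have hW' : phaseCost ℓ (t + 1) = phaseStep W c := rfl
    rw [hW', cost_succ, hK1]
    rw [hK1] at ih
    by_cases hne : (unsaturated (W + c)).Nonempty
    · have hstep : phaseStep W c = W + c := if_pos hne
      have hmove : ∀ ω, (markingAlg x₀ (e ω)).state x₀ ℓ p (t + 1) =
          firstIn x₀ (e ω) (unsaturated (W + c)) := fun ω => by
        rw [markingAlg_state_succ]; exact if_pos hne
      rw [hstep]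
      set U := unsaturated W with hU
      set U' := unsaturated (W + c) with hU'
      have hsub : U' ⊆ U := unsaturated_add_subset W c
      have hcost : ∫⁻ ω, (cost ℓ (t + 1) ((markingAlg x₀ (e ω)).state x₀ ℓ p) +
          edist ((markingAlg x₀ (e ω)).state x₀ ℓ p (t + 1)) (firstIn x₀ (e ω) U')) ∂μ ≤
          A + (β U.card * (U \ U').card + β U'.card * ∑ x ∈ U', c x) := by
        calc _ ≤ ∫⁻ ω, ((cost ℓ t ((markingAlg x₀ (e ω)).state x₀ ℓ p) +
                edist ((markingAlg x₀ (e ω)).state x₀ ℓ p t) (firstIn x₀ (e ω) U)) +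
                (edist (firstIn x₀ (e ω) U) (firstIn x₀ (e ω) U') + c (firstIn x₀ (e ω) U'))) ∂μ := by
              refine lintegral_mono fun ω => ?_
              simp only [cost_succ, hmove, edist_self, add_zero, ← hc]
              rw [add_assoc, ← add_assoc (edist _ (firstIn x₀ (e ω) U))]
              gcongr
              exact edist_triangle _ _ _
          _ = A + ((∫⁻ ω, edist (firstIn x₀ (e ω) U) (firstIn x₀ (e ω) U') ∂μ) +
                ∫⁻ ω, c (firstIn x₀ (e ω) U') ∂μ) := by
              rw [lintegral_add_left (hmf _)]
              congr 1
              exact lintegral_add_left (hmf _) _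
          _ ≤ _ := by
              gcongr
              · exact lintegral_edist_firstIn_le hmeas hβ (hne.mono hsub) hsub
              · exact lintegral_firstIn_le hmeas hβ hne _
      have hmov : (β U.card : ℝ≥0∞) * (U \ U').card + B U'.card ≤ B U.card := by
        have := mul_add_partialSum_le hanti U'.card (U \ U').card
        rw [Finset.card_sdiff_of_subset hsub,
          Nat.add_sub_cancel' (Finset.card_le_card hsub)] at this
        rw [Finset.card_sdiff_of_subset hsub]
        exact_mod_cast this
      have hsat := saturation_le hanti hsub hne fun x hx => (mem_unsaturated.1 hx).le
      have hmin := min_one_phase_le W c (y t) (y (t + 1))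
      -- Finiteness allows the subtracted part of the old potential to be added to both sides.
      have hfin : (β U.card : ℝ≥0∞) * ∑ x ∈ U, W x ≠ ⊤ :=
        ((sum_unsaturated_le_partialSum hanti W).trans_lt ENNReal.coe_lt_top).ne
      have hsplit : ∑ x ∈ U', (W + c) x = ∑ x ∈ U', W x + ∑ x ∈ U', c x :=
        Finset.sum_add_distrib
      rw [hsplit, ← ENNReal.add_le_add_iff_right hfin]
      set S := (β U.card : ℝ≥0∞) * ∑ x ∈ U, W x
      set d := edist (y t) (y (t + 1)) + c (y (t + 1))
      calc _ ≤ A + (β U.card * (U \ U').card + β U'.card * ∑ x ∈ U', c x) + 2 * B U'.card +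
              K * (min 1 (W (y t)) + d) + S := by gcongr; exact hmin
        _ = A + (β U.card * (U \ U').card + B U'.card) + (B U'.card + S) +
              β U'.card * ∑ x ∈ U', c x + K * (min 1 (W (y t)) + d) := by ring
        _ ≤ A + B U.card + (B U.card + β U'.card * ∑ x ∈ U', W x) +
              β U'.card * ∑ x ∈ U', c x + K * (min 1 (W (y t)) + d) := by gcongr
        _ = (A + 2 * B U.card + K * min 1 (W (y t))) + K * d +
              β U'.card * (∑ x ∈ U', W x + ∑ x ∈ U', c x) := by ring
        _ ≤ ((K + 1) * cost ℓ t y + (2 * B n + 1) + S) + (K + 1) * d +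
              β U'.card * (∑ x ∈ U', W x + ∑ x ∈ U', c x) := by
              gcongr
              exact le_self_add
        _ = _ := by ring
    · have hstep : phaseStep W c = 0 := if_neg hne
      have hmove : ∀ ω, (markingAlg x₀ (e ω)).state x₀ ℓ p (t + 1) =
          (exists_cheapest x₀ c).choose := fun ω => by
        rw [markingAlg_state_succ]; exact if_neg hne
      have hcheap := (exists_cheapest x₀ c).choose_spec (y (t + 1))
      have hcard : (unsaturated (0 : CostFn (UniformMetric n))).card = n := by
        rw [unsaturated_zero, Finset.card_univ, UniformMetric.card]
      have hcost : ∫⁻ ω, (cost ℓ (t + 1) ((markingAlg x₀ (e ω)).state x₀ ℓ p) +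
          edist ((markingAlg x₀ (e ω)).state x₀ ℓ p (t + 1))
            (firstIn x₀ (e ω) (unsaturated 0))) ∂μ ≤ A + (2 + c (y (t + 1))) := by
        calc _ ≤ ∫⁻ ω, ((cost ℓ t ((markingAlg x₀ (e ω)).state x₀ ℓ p) +
                edist ((markingAlg x₀ (e ω)).state x₀ ℓ p t)
                  (firstIn x₀ (e ω) (unsaturated W))) + (2 + c (y (t + 1)))) ∂μ := by
              refine lintegral_mono fun ω => ?_
              simp only [cost_succ, hmove, ← hc]
              calc _ ≤ cost ℓ t ((markingAlg x₀ (e ω)).state x₀ ℓ p) +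
                      (1 + c (y (t + 1))) + 1 := by
                    gcongr
                    · exact UniformMetric.edist_le_one _ _
                    · exact UniformMetric.edist_le_one _ _
                _ = cost ℓ t ((markingAlg x₀ (e ω)).state x₀ ℓ p) + (2 + c (y (t + 1))) := by ring
                _ ≤ _ := by gcongr; exact le_self_add
          _ = _ := by
              rw [lintegral_add_left (hmf _), lintegral_const, measure_univ, mul_one]
      -- The phase ends because every state, including `y (t + 1)`, has accumulated `1`.
      have hone : 1 ≤ min 1 (W (y t)) + (edist (y t) (y (t + 1)) + c (y (t + 1))) := by
        have h1 : 1 ≤ W (y (t + 1)) + c (y (t + 1)) := by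
          by_contra h
          exact hne ⟨y (t + 1), mem_unsaturated.2 (not_le.1 h)⟩
        exact (le_min le_rfl h1).trans (min_one_phase_le W c (y t) (y (t + 1)))
      have hbase : A + K * min 1 (W (y t)) ≤ (K + 1) * cost ℓ t y + (2 * B n + 1) := by
        have hfin : (2 * B (unsaturated W).card : ℝ≥0∞) ≠ ⊤ := by finiteness
        rw [← ENNReal.add_le_add_iff_right hfin]
        calc _ = A + 2 * B (unsaturated W).card + K * min 1 (W (y t)) := by ring
          _ ≤ _ := ih
          _ ≤ _ := by
            refine add_le_add le_rfl ((sum_unsaturated_le_partialSum hanti W).trans ?_)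
            rw [two_mul]
            exact le_self_add
      rw [hstep, hcard]
      simp only [Pi.zero_apply, zero_le, inf_of_le_right, mul_zero, add_zero,
        Finset.sum_const_zero]
      set d := edist (y t) (y (t + 1)) + c (y (t + 1)) with hd
      calc _ ≤ A + (2 + c (y (t + 1))) + 2 * B n := by gcongr
        _ = A + K * 1 + c (y (t + 1)) := by rw [hK]; ring
        _ ≤ A + K * (min 1 (W (y t)) + d) + d := by
            gcongr
            exact le_add_self
        _ = (A + K * min 1 (W (y t))) + (K + 1) * d := by ring
        _ ≤ ((K + 1) * cost ℓ t y + (2 * B n + 1)) + (K + 1) * d := by gcongr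
        _ = _ := by ring

end Marking

/-! ### Ratios without predictions and the lower bounds. -/

section Ratio

variable {n : ℕ} {x₀ : UniformMetric n} {β : ℕ → ℝ≥0}

theorem RandAlg.isCompetitive_of_marking (R : RandAlg (UniformMetric n))
    (e : R.Ω → UniformMetric n ≃ Fin n) (hR : ∀ ω, R.alg ω = markingAlg x₀ (e ω))
    (hmeas : ∀ s : Set R.Ω, MeasurableSet s)
    (hβ : ∀ (U : Finset (UniformMetric n)), ∀ x ∈ U,
      R.μ {ω | firstIn x₀ (e ω) U = x} ≤ β U.card)
    (hanti : ∀ i j, 1 ≤ i → i ≤ j → β j ≤ β i) :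
    R.IsCompetitive x₀ (2 * partialSum β n + 3) := by
  refine ⟨2 * partialSum β n + 1, fun ℓ p T => ?_⟩
  have h : ∀ y : ℕ → UniformMetric n, y 0 = x₀ → R.expectedCost x₀ ℓ p T ≤
      (2 * partialSum β n + 3) * cost ℓ T y + (2 * partialSum β n + 1) := by
    intro y _
    have hinv := markingAlg_invariant (μ := R.μ) hmeas hβ hanti ℓ p y T
    set u := (unsaturated (phaseCost ℓ T)).card
    have hfin : (2 * partialSum β u : ℝ≥0∞) ≠ ⊤ := by finiteness
    rw [← ENNReal.add_le_add_iff_right hfin]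
    calc _ ≤ _ := le_trans ?_ hinv
      _ ≤ _ := by
        refine add_le_add le_rfl ((sum_unsaturated_le_partialSum hanti _).trans ?_)
        rw [two_mul]
        exact le_self_add
    refine le_trans (add_le_add (lintegral_mono fun ω => ?_) le_rfl) le_self_add
    rw [hR ω]
    exact le_self_add
  push_cast
  have hK0 : (2 * partialSum β n + 3 : ℝ≥0∞) ≠ 0 := by simp
  have hKt : (2 * partialSum β n + 3 : ℝ≥0∞) ≠ ⊤ := by finiteness
  -- Isolating `opt` reduces the claim to each competing solution `y`.
  rw [← tsub_le_iff_right, mul_comm _ (opt x₀ ℓ T), ← ENNReal.div_le_iff hK0 hKt]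
  refine le_iInf₂ fun y hy => ?_
  rw [ENNReal.div_le_iff hK0 hKt, tsub_le_iff_right, mul_comm (cost ℓ T y)]
  exact h y hy

theorem detRatio_le (x₀ : UniformMetric n) : detRatio x₀ ≤ ((2 * n + 3 : ℝ≥0) : ℝ≥0∞) := by
  refine iInf₂_le _ ⟨markingAlg x₀ (Equiv.refl _), fun _ _ => rfl, ?_⟩
  have := (markingAlg x₀ (Equiv.refl _)).toRand.isCompetitive_of_marking (x₀ := x₀)
    (β := fun _ => 1) (fun _ => Equiv.refl _) (fun _ => rfl)
    (fun _ => MeasurableSpace.measurableSet_top) (fun U x _ => by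
      simpa using prob_le_one) (fun _ _ _ _ => le_rfl)
  simpa [partialSum] using this

/-- The marking algorithm with a uniformly random order of the states. -/
noncomputable def randMarkingAlg (x₀ : UniformMetric n) : RandAlg (UniformMetric n) where
  Ω := UniformMetric n ≃ Fin n
  mΩ := ⊤
  μ := letI : Nonempty (UniformMetric n ≃ Fin n) := ⟨Equiv.refl _⟩
    @PMF.toMeasure _ ⊤ (PMF.uniformOfFintype (UniformMetric n ≃ Fin n))
  prob := @PMF.toMeasure.isProbabilityMeasure _ ⊤ _
  alg e := markingAlg x₀ e
  measurable_state := fun _ _ _ _ _ => MeasurableSpace.measurableSet_top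
  measurable_queried := fun _ _ _ => MeasurableSpace.measurableSet_top

theorem randMarkingAlg_firstIn (x₀ : UniformMetric n) (U : Finset (UniformMetric n))
    (x : UniformMetric n) (hx : x ∈ U) :
    (randMarkingAlg x₀).μ {e : UniformMetric n ≃ Fin n | firstIn x₀ e U = x} ≤
      ((U.card : ℝ≥0)⁻¹ : ℝ≥0) := by
  classical
  let _ : Nonempty (UniformMetric n ≃ Fin n) := ⟨Equiv.refl _⟩
  have h : (randMarkingAlg x₀).μ {e : UniformMetric n ≃ Fin n | firstIn x₀ e U = x} =
      (Fintype.card {e : UniformMetric n ≃ Fin n | firstIn x₀ e U = x} : ℝ≥0∞) /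
        Fintype.card (UniformMetric n ≃ Fin n) :=
    @PMF.toMeasure_uniformOfFintype_apply (UniformMetric n ≃ Fin n) _ _
      {e : UniformMetric n ≃ Fin n | firstIn x₀ e U = x} ⊤ MeasurableSpace.measurableSet_top _
  have hcard := card_mul_card_firstIn x₀ hx
  have hU : (U.card : ℝ≥0) ≠ 0 := by
    exact_mod_cast (Finset.card_pos.2 ⟨x, hx⟩).ne'
  rw [h, show Fintype.card {e : UniformMetric n ≃ Fin n | firstIn x₀ e U = x} = _ from
    Fintype.card_subtype fun e : UniformMetric n ≃ Fin n => firstIn x₀ e U = x, ← hcard, ENNReal.coe_inv hU]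
  have hpos : ((Finset.univ.filter fun e : UniformMetric n ≃ Fin n =>
      firstIn x₀ e U = x).card : ℝ≥0∞) ≠ 0 := by
    intro h0
    rw [Nat.cast_eq_zero] at h0
    rw [h0, mul_zero] at hcard
    exact Fintype.card_ne_zero hcard.symm
  push_cast
  rw [ENNReal.div_le_iff (by simp_all) (by finiteness), ← mul_assoc,
    ENNReal.inv_mul_cancel (by simpa using hU) (by finiteness), one_mul]

/-- With `β u = 1 / u` the partial sum is a harmonic number, at most `1 + log n`. -/
theorem randRatio_le (x₀ : UniformMetric n) :
    randRatio x₀ ≤ ENNReal.ofReal (2 * Real.log n + 5) := by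
  have hcomp := (randMarkingAlg x₀).isCompetitive_of_marking (x₀ := x₀)
    (β := fun u => (u : ℝ≥0)⁻¹) id (fun _ => rfl)
    (fun _ => MeasurableSpace.measurableSet_top) (randMarkingAlg_firstIn x₀)
    (fun i j hi hij => by
      have : (0 : ℝ≥0) < i := by exact_mod_cast hi
      gcongr)
  refine (iInf₂_le _ ⟨randMarkingAlg x₀, fun _ _ _ => rfl, hcomp⟩).trans ?_
  rw [← ENNReal.ofReal_coe_nnreal]
  refine ENNReal.ofReal_le_ofReal ?_
  have h := harmonic_le_one_add_log n
  have hsum : ((harmonic n : ℚ) : ℝ) = partialSum (fun u => (u : ℝ≥0)⁻¹) n := by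
    simp [harmonic, partialSum]
  rw [hsum] at h
  push_cast
  linarith

theorem log_le_of_vulnerable {r : ℝ≥0} (h : Nat.log 2 n * (2⁻¹ : ℝ≥0) + 1 ≤ 2 * r) :
    Real.log n ≤ 4 * r := by
  rcases Nat.eq_zero_or_pos n with rfl | hn
  · simp
  have h1 : (n : ℝ) ≤ 2 ^ (Nat.log 2 n + 1) := by
    exact_mod_cast (Nat.lt_pow_succ_log_self one_lt_two n).le
  have h2 : Real.log n ≤ (Nat.log 2 n + 1 : ℕ) * Real.log 2 := by
    rw [← Real.log_pow]
    exact Real.log_le_log (by exact_mod_cast hn) h1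
  have h3 : (Nat.log 2 n * (2⁻¹ : ℝ) + 1) ≤ 2 * r := by exact_mod_cast h
  have h4 : ((Nat.log 2 n + 1 : ℕ) : ℝ) * Real.log 2 ≤ (Nat.log 2 n + 1 : ℕ) * 1 := by
    gcongr
    exact (Real.log_two_lt_d9.trans (by norm_num)).le
  push_cast at h2 h4
  linarith

theorem le_detRatio (x₀ : UniformMetric n) : (n : ℝ≥0∞) ≤ 2 * detRatio x₀ := by
  rw [mul_comm, ← ENNReal.div_le_iff (by simp) (by simp)]
  refine le_iInf₂ fun r ⟨A, _, hA⟩ => ?_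
  rw [ENNReal.div_le_iff (by simp) (by simp)]
  have hn : 0 < n := Fin.pos (n := n) x₀
  have h := hA.le_of_vulnerable (A.vulnerable x₀) (k := n - 1) (Nat.sub_add_cancel hn).le
  have h' : ((n - 1 + 1 : ℕ) : ℝ≥0) ≤ 2 * r := by push_cast; simpa using h
  rw [Nat.sub_add_cancel hn, mul_comm] at h'
  exact_mod_cast h'

theorem log_le_randRatio (x₀ : UniformMetric n) :
    ENNReal.ofReal (Real.log n) ≤ 4 * randRatio x₀ := by
  rw [mul_comm, ← ENNReal.div_le_iff (by simp) (by simp)]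
  refine le_iInf₂ fun r ⟨R, _, hR⟩ => ?_
  rw [ENNReal.div_le_iff (by simp) (by simp)]
  have hn : 0 < n := Fin.pos (n := n) x₀
  have h := log_le_of_vulnerable
    (hR.le_of_vulnerable (R.vulnerable x₀) (Nat.pow_log_le_self 2 hn.ne'))
  refine (ENNReal.ofReal_le_ofReal h).trans ?_
  rw [ENNReal.ofReal_mul (by norm_num), mul_comm]
  simp

/-- If `n < a * ρ`, the longest phases give `n ≤ 2 * r`, hence `2 * n + 3 ≤ 7 * r`. If `2 < a * ρ ≤
n`, phases of about `a * ρ` tasks fit the budget. Otherwise `1 ≤ r` suffices. -/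
theorem DetAlg.ratio_lower_bound {A : DetAlg (UniformMetric n)} {off : OptimalOffline x₀} {a : ℕ}
    (ha : 1 ≤ a) (hsep : A.WellSeparated a) {ρ r : ℝ≥0}
    (hA : A.toRand.IsCompetitiveWithError x₀ off ρ r) :
    min (detRatio x₀) (1 + a * ρ) ≤ 7 * r := by
  have hr := hA.one_le
  have hn : 0 < n := Fin.pos (n := n) x₀
  have key : ∀ k : ℕ, k + 1 ≤ n → (k + 1 : ℝ≥0) < a * ρ → (k + 1 : ℝ≥0) ≤ 2 * r :=
    fun k hk hka => by
      simpa using hA.le_of_vulnerable ha (fun _ => hsep) (A.vulnerable x₀) hk hka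
  by_cases hna : (n : ℝ≥0) < a * ρ
  · refine (min_le_left _ _).trans ((detRatio_le x₀).trans ?_)
    have h := key (n - 1) (Nat.sub_add_cancel hn).le
    rw [show ((n - 1 : ℕ) : ℝ≥0) + 1 = n by exact_mod_cast Nat.sub_add_cancel hn] at h
    have : 2 * (n : ℝ≥0) + 3 ≤ 7 * r := by
      have := h hna
      rw [← NNReal.coe_le_coe] at this hr ⊢
      push_cast at this hr ⊢
      linarith
    exact_mod_cast this
  · refine (min_le_right _ _).trans ?_
    suffices h : 1 + a * ρ ≤ 7 * r by exact_mod_cast h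
    rw [not_lt] at hna
    by_cases h2 : 2 < a * ρ
    · set c := ⌈a * ρ⌉₊ with hc
      have hc1 : a * ρ ≤ c := Nat.le_ceil _
      have hc2 : (c : ℝ≥0) < a * ρ + 1 := Nat.ceil_lt_add_one zero_le
      have hc3 : 2 < c := by exact_mod_cast h2.trans_le hc1
      have hc4 : c ≤ n := Nat.ceil_le.2 hna
      -- Subtracting `2` from the ceiling gives the strict `k + 1 < a * ρ`, with `a * ρ ≤ k + 2`.
      obtain ⟨k, hk⟩ : ∃ k, c = k + 2 := ⟨c - 2, by omega⟩
      have hk' : (c : ℝ≥0) = k + 2 := by rw [hk]; push_cast; rfl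
      have h := key k (by omega) (by
        rw [← NNReal.coe_lt_coe] at hc2 ⊢
        rw [hk'] at hc2
        push_cast at hc2 ⊢
        linarith)
      rw [hk'] at hc1
      rw [← NNReal.coe_le_coe] at hc1 h hr ⊢
      push_cast at hc1 h hr ⊢
      linarith
    · rw [not_lt] at h2
      rw [← NNReal.coe_le_coe] at h2 hr ⊢
      push_cast at h2 hr ⊢
      linarith

/-- The same regimes, with threshold `Nat.log 2 n + 1`. The constant is `13` because `log n ≤ 4 * r`
and `1 ≤ r` give `2 * log n + 5 ≤ 13 * r`. -/
theorem RandAlg.ratio_lower_bound {R : RandAlg (UniformMetric n)} {off : OptimalOffline x₀} {a : ℕ}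
    (ha : 1 ≤ a) (hsep : R.WellSeparated a) {ρ r : ℝ≥0}
    (hR : R.IsCompetitiveWithError x₀ off ρ r) :
    min (randRatio x₀) (1 + a * ρ) ≤ 13 * r := by
  have hr := hR.one_le
  have hn : 0 < n := Fin.pos (n := n) x₀
  have key : ∀ k : ℕ, k ≤ Nat.log 2 n → (k + 1 : ℝ≥0) < a * ρ → (k * 2⁻¹ + 1 : ℝ≥0) ≤ 2 * r :=
    fun k hk hka => hR.le_of_vulnerable ha hsep (R.vulnerable x₀)
      (Nat.pow_le_of_le_log hn.ne' hk) hka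
  by_cases hna : (Nat.log 2 n + 1 : ℝ≥0) < a * ρ
  · refine (min_le_left _ _).trans ((randRatio_le x₀).trans ?_)
    have h := log_le_of_vulnerable (key _ le_rfl hna)
    have : 2 * Real.log n + 5 ≤ ((13 * r : ℝ≥0) : ℝ) := by
      rw [← NNReal.coe_le_coe] at hr
      push_cast at hr ⊢
      linarith
    refine (ENNReal.ofReal_le_ofReal this).trans ?_
    rw [ENNReal.ofReal_coe_nnreal]
    push_cast
    rfl
  · refine (min_le_right _ _).trans ?_
    suffices h : 1 + a * ρ ≤ 13 * r by exact_mod_cast h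
    rw [not_lt] at hna
    by_cases h2 : 2 < a * ρ
    · set c := ⌈a * ρ⌉₊ with hc
      have hc1 : a * ρ ≤ c := Nat.le_ceil _
      have hc2 : (c : ℝ≥0) < a * ρ + 1 := Nat.ceil_lt_add_one zero_le
      have hc3 : 2 < c := by exact_mod_cast h2.trans_le hc1
      have hc4 : c ≤ Nat.log 2 n + 1 := Nat.ceil_le.2 (by exact_mod_cast hna)
      obtain ⟨k, hk⟩ : ∃ k, c = k + 2 := ⟨c - 2, by omega⟩
      have hk' : (c : ℝ≥0) = k + 2 := by rw [hk]; push_cast; rfl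
      have h := key k (by omega) (by
        rw [← NNReal.coe_lt_coe] at hc2 ⊢
        rw [hk'] at hc2
        push_cast at hc2 ⊢
        linarith)
      rw [hk'] at hc1
      rw [← NNReal.coe_le_coe] at hc1 h hr ⊢
      push_cast at hc1 h hr ⊢
      linarith
    · rw [not_lt] at h2
      rw [← NNReal.coe_le_coe] at h2 hr ⊢
      push_cast at h2 hr ⊢
      linarith

end Ratio

/-! ### Non-smoothness and assembly. -/

theorem not_smooth_of_isLittleO
    (off : (n : ℕ) → (x₀ : UniformMetric n) → OptimalOffline x₀)
    (f : ℕ → ℝ≥0 → ℝ≥0) (a : ℕ → ℕ) (ρ : ℕ → ℝ≥0)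
    (htend : Tendsto (fun k => (a k : ℝ) * (ρ k : ℝ)) atTop atTop)
    (hf : (fun k => (f (a k) (ρ k) : ℝ)) =o[atTop] (fun k => (a k : ℝ) * (ρ k : ℝ))) :
    ∀ᶠ k in atTop, ¬ ∃ R : (n : ℕ) → UniformMetric n → RandAlg (UniformMetric n),
      ∀ (n : ℕ) (x₀ : UniformMetric n), (R n x₀).WellSeparated (a k) ∧
        (R n x₀).IsSmooth x₀ (off n x₀) (f (a k)) := by
  filter_upwards [hf.def (show (0 : ℝ) < 1 / 13 by norm_num), htend.eventually_ge_atTop 1]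
    with k hk hge
  rintro ⟨R, hR⟩
  have ha : 1 ≤ a k := by
    rw [Nat.one_le_iff_ne_zero]
    intro h
    rw [h] at hge
    norm_num at hge
  -- The size `n` is chosen after `k`, so that `log n / 4`, a lower bound for `randRatio`, exceeds
  -- `1 + a k * ρ k`.
  obtain ⟨n, hn⟩ := exists_nat_ge (Real.exp (4 * (1 + a k * ρ k)))
  have hexp := Real.exp_pos (4 * (1 + a k * ρ k : ℝ))
  have hn0 : 0 < n := by exact_mod_cast hexp.trans_le hn
  have hlog : 4 * (1 + a k * ρ k : ℝ) ≤ Real.log n := by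
    rw [← Real.log_exp (4 * (1 + a k * ρ k : ℝ))]
    exact Real.log_le_log hexp hn
  let x₀ : UniformMetric n := (⟨0, hn0⟩ : Fin n)
  have hratio : ((1 + a k * ρ k : ℝ≥0) : ℝ≥0∞) ≤ randRatio x₀ := by
    have h := (ENNReal.ofReal_le_ofReal hlog).trans (log_le_randRatio x₀)
    rw [ENNReal.ofReal_mul (by norm_num)] at h
    have h4 : ENNReal.ofReal 4 = 4 := by simp
    rw [h4, ENNReal.mul_le_mul_iff_right (by norm_num) (by norm_num)] at h
    refine le_trans (le_of_eq ?_) h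
    rw [← ENNReal.ofReal_coe_nnreal]
    push_cast
    rfl
  have hlow := RandAlg.ratio_lower_bound ha (hR n x₀).1 ((hR n x₀).2 (ρ k))
  rw [min_eq_right (by exact_mod_cast hratio)] at hlow
  have hlow' : (1 : ℝ) + a k * ρ k ≤ 13 * f (a k) (ρ k) := by exact_mod_cast hlow
  rw [Real.norm_of_nonneg (by positivity), Real.norm_of_nonneg (by positivity)] at hk
  linarith

theorem coe_inv_thirteen_mul_le {x : ℝ≥0∞} {r : ℝ≥0} (h : x ≤ 13 * r) :
    ((13⁻¹ : ℝ≥0) : ℝ≥0∞) * x ≤ r := by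
  rw [ENNReal.coe_inv (by norm_num), mul_comm, ← div_eq_mul_inv,
    ENNReal.div_le_iff (by norm_num) (by simp), mul_comm]
  exact_mod_cast h

end MTS

theorem mainTheorem5 :
    ∃ c C : ℝ≥0, 0 < c ∧
      -- `α_n = Θ(n)` for deterministic and `α_n = Θ(log n)` for randomized algorithms
      (∀ (n : ℕ) (x₀ : MTS.UniformMetric n),
        (c : ℝ≥0∞) * n ≤ MTS.detRatio x₀ ∧ MTS.detRatio x₀ ≤ C * n) ∧
      (∀ n : ℕ, 2 ≤ n → ∀ x₀ : MTS.UniformMetric n,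
        (c : ℝ≥0∞) * ENNReal.ofReal (Real.log n) ≤ MTS.randRatio x₀ ∧
          MTS.randRatio x₀ ≤ C * ENNReal.ofReal (Real.log n)) ∧
      -- the lower bound for deterministic algorithms
      (∀ (n : ℕ) (x₀ : MTS.UniformMetric n) (off : MTS.OptimalOffline x₀) (a : ℕ), 1 ≤ a →
        ∀ A : MTS.DetAlg (MTS.UniformMetric n), A.WellSeparated a →
        ∀ ρ r : ℝ≥0, A.toRand.IsCompetitiveWithError x₀ off ρ r →
          (c : ℝ≥0∞) * min (MTS.detRatio x₀) (1 + a * ρ) ≤ r) ∧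
      -- the lower bound for randomized algorithms
      (∀ (n : ℕ) (x₀ : MTS.UniformMetric n) (off : MTS.OptimalOffline x₀) (a : ℕ), 1 ≤ a →
        ∀ R : MTS.RandAlg (MTS.UniformMetric n), R.WellSeparated a →
        ∀ ρ r : ℝ≥0, R.IsCompetitiveWithError x₀ off ρ r →
          (c : ℝ≥0∞) * min (MTS.randRatio x₀) (1 + a * ρ) ≤ r) ∧
      -- no `o(a η / OPT)`-smooth algorithm, in any regime in which `a η / OPT` tends to infinity
      (∀ off : (n : ℕ) → (x₀ : MTS.UniformMetric n) → MTS.OptimalOffline x₀,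
        ∀ (f : ℕ → ℝ≥0 → ℝ≥0) (a : ℕ → ℕ) (ρ : ℕ → ℝ≥0),
          Tendsto (fun k => (a k : ℝ) * (ρ k : ℝ)) atTop atTop →
          (fun k => (f (a k) (ρ k) : ℝ)) =o[atTop] (fun k => (a k : ℝ) * (ρ k : ℝ)) →
          ∀ᶠ k in atTop,
            ¬ ∃ R : (n : ℕ) → MTS.UniformMetric n → MTS.RandAlg (MTS.UniformMetric n),
              ∀ (n : ℕ) (x₀ : MTS.UniformMetric n), (R n x₀).WellSeparated (a k) ∧
                (R n x₀).IsSmooth x₀ (off n x₀) (f (a k))) := by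
  have hc : ((13⁻¹ : ℝ≥0) : ℝ≥0∞) ≤ 4⁻¹ := by
    rw [ENNReal.coe_inv (by norm_num)]
    exact ENNReal.inv_le_inv.2 (by norm_num)
  -- The constant `10` covers `2 * n + 3` for `n ≥ 1` and `2 * log n + 5` for `n ≥ 2`, the latter
  -- since `8 * log 2 > 5`.
  refine ⟨13⁻¹, 10, by norm_num, fun n x₀ => ⟨?_, ?_⟩, fun n hn x₀ => ⟨?_, ?_⟩,
    fun n x₀ off a ha A hsep ρ r hA => ?_, fun n x₀ off a ha R hsep ρ r hR => ?_,
    MTS.not_smooth_of_isLittleO⟩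
  · refine (mul_le_mul' hc (MTS.le_detRatio x₀)).trans ?_
    rw [← mul_assoc]
    refine mul_le_of_le_one_left' ?_
    rw [mul_comm, ← div_eq_mul_inv]
    exact ENNReal.div_le_of_le_mul (by norm_num)
  · refine (MTS.detRatio_le x₀).trans ?_
    have hn : 1 ≤ n := Fin.pos (n := n) x₀
    exact_mod_cast (show 2 * n + 3 ≤ 10 * n by omega)
  · refine (mul_le_mul' hc (MTS.log_le_randRatio x₀)).trans ?_
    rw [← mul_assoc, ENNReal.inv_mul_cancel (by norm_num) (by norm_num), one_mul]
  · refine (MTS.randRatio_le x₀).trans ?_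
    have hlog : Real.log 2 ≤ Real.log n :=
      Real.log_le_log (by norm_num) (by exact_mod_cast hn)
    have h2 := Real.log_two_gt_d9
    rw [show ((10 : ℝ≥0) : ℝ≥0∞) = ENNReal.ofReal 10 by simp,
      ← ENNReal.ofReal_mul (by norm_num)]
    exact ENNReal.ofReal_le_ofReal (by linarith)
  · refine MTS.coe_inv_thirteen_mul_le ((MTS.DetAlg.ratio_lower_bound ha hsep hA).trans ?_)
    gcongr
    norm_num
  · exact MTS.coe_inv_thirteen_mul_le (MTS.RandAlg.ratio_lower_bound ha hsep hR)
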